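/- Let $X$ be an infinite-dimensional real or complex Banach space and let $T$ be a bounded linear operator on $X$. Let $\rho_\infty(T)$ denote the unbounded connected component of the resolvent set $\rho(T)\subseteq\mathbb{C}$; if $X$ is real, $\rho(T)$ and $\rho_\infty(T)$ are understood to be those of the complexification $T_{\mathbb C}(x\oplus iy)=Tx\oplus iTy$ acting on the complexification $X_{\mathbb C}=X\oplus iX$, normed by $\|x\oplus iy\|=\sup_{\theta\in[0,2\pi]}\|x\cos\theta+y\sin\theta\|$. Suppose that for some $e\in X$ the orbit $(T^ne)_{n=0}^\infty$ is a minimal system, i.e. there are bounded linear functionals $x_n^*\in X^*$ $(n\ge 0)$ with $x_n^*(T^me)=\delta_{n,m}$ for all $n,m\geq 0$, and that $(-\varepsilon,0)\subseteq\rho_\infty(T)$ for some $\varepsilon>0$. Then $T$ admits an almost-invariant halfspace with error contained in $[e]$, the closed linear span of $e$: there are a closed subspace $Y$ of $X$ with $\dim Y=\dim (X/Y)=\infty$ and a finite-dimensional subspace $E\subseteq[e]$ such that $TY\subseteq Y+E$. -/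

import Mathlib

universe u v

/-- The complexification `X ⊕ iX` of a real vector space; `⟨x, y⟩` stands for `x ⊕ iy`. -/
@[ext]
structure Complexification (X : Type u) where
  re : X
  im : X

namespace Complexification

variable {X : Type u} [NormedAddCommGroup X]

instance : Add (Complexification X) := ⟨fun z w => ⟨z.re + w.re, z.im + w.im⟩⟩

instance : Zero (Complexification X) := ⟨⟨0, 0⟩⟩

instance : Neg (Complexification X) := ⟨fun z => ⟨-z.re, -z.im⟩⟩

@[simp] theorem add_re (z w : Complexification X) : (z + w).re = z.re + w.re := rfl
@[simp] theorem add_im (z w : Complexification X) : (z + w).im = z.im + w.im := rfl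
@[simp] theorem zero_re : (0 : Complexification X).re = 0 := rfl
@[simp] theorem zero_im : (0 : Complexification X).im = 0 := rfl
@[simp] theorem neg_re (z : Complexification X) : (-z).re = -z.re := rfl
@[simp] theorem neg_im (z : Complexification X) : (-z).im = -z.im := rfl

variable [NormedSpace ℝ X]

/-- `(a + ib)(x ⊕ iy) = (ax - by) ⊕ i(bx + ay)`. -/
instance : SMul ℂ (Complexification X) :=
  ⟨fun c z => ⟨c.re • z.re - c.im • z.im, c.im • z.re + c.re • z.im⟩⟩

/-- `‖x ⊕ iy‖ = sup_θ ‖x cos θ + y sin θ‖`; by periodicity it is the same to let `θ` range over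
`[0, 2π]` or over `ℝ`. -/
noncomputable instance : Norm (Complexification X) :=
  ⟨fun z => ⨆ θ : ℝ, ‖Real.cos θ • z.re + Real.sin θ • z.im‖⟩

@[simp] theorem smul_re (c : ℂ) (z : Complexification X) :
    (c • z).re = c.re • z.re - c.im • z.im := rfl
@[simp] theorem smul_im (c : ℂ) (z : Complexification X) :
    (c • z).im = c.im • z.re + c.re • z.im := rfl

theorem norm_def (z : Complexification X) :
    ‖z‖ = ⨆ θ : ℝ, ‖Real.cos θ • z.re + Real.sin θ • z.im‖ := rfl

instance : AddCommGroup (Complexification X) where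
  add_assoc a b c := by ext <;> simp [add_assoc]
  zero_add a := by ext <;> simp
  add_zero a := by ext <;> simp
  neg_add_cancel a := by ext <;> simp
  add_comm a b := by ext <;> simp [add_comm]
  nsmul := nsmulRec
  zsmul := zsmulRec

instance : Module ℂ (Complexification X) where
  one_smul z := by ext <;> simp
  mul_smul a b z := by
    ext <;> simp only [smul_re, smul_im, Complex.mul_re, Complex.mul_im] <;> module
  smul_zero a := by ext <;> simp
  smul_add a z w := by ext <;> simp only [smul_re, smul_im, add_re, add_im] <;> module
  add_smul a b z := by
    ext <;> simp only [smul_re, smul_im, add_re, add_im, Complex.add_re, Complex.add_im] <;> module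
  zero_smul z := by ext <;> simp

theorem norm_rotation_le (x y : X) (θ : ℝ) :
    ‖Real.cos θ • x + Real.sin θ • y‖ ≤ ‖x‖ + ‖y‖ := by
  refine (norm_add_le _ _).trans (add_le_add ?_ ?_)
  · rw [norm_smul, Real.norm_eq_abs]
    exact mul_le_of_le_one_left (norm_nonneg _) (Real.abs_cos_le_one θ)
  · rw [norm_smul, Real.norm_eq_abs]
    exact mul_le_of_le_one_left (norm_nonneg _) (Real.abs_sin_le_one θ)

theorem bddAbove_rotation (z : Complexification X) :
    BddAbove (Set.range fun θ : ℝ => ‖Real.cos θ • z.re + Real.sin θ • z.im‖) :=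
  ⟨‖z.re‖ + ‖z.im‖, by rintro _ ⟨θ, rfl⟩; exact norm_rotation_le _ _ _⟩

theorem rotation_le_norm (z : Complexification X) (θ : ℝ) :
    ‖Real.cos θ • z.re + Real.sin θ • z.im‖ ≤ ‖z‖ :=
  le_ciSup (bddAbove_rotation z) θ

theorem norm_le_add (z : Complexification X) : ‖z‖ ≤ ‖z.re‖ + ‖z.im‖ :=
  ciSup_le fun θ => norm_rotation_le _ _ θ

theorem norm_re_le (z : Complexification X) : ‖z.re‖ ≤ ‖z‖ := by
  simpa using rotation_le_norm z 0

theorem norm_im_le (z : Complexification X) : ‖z.im‖ ≤ ‖z‖ := by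
  simpa using rotation_le_norm z (Real.pi / 2)

theorem norm_smul_eq' (c : ℂ) (z : Complexification X) : ‖c • z‖ = ‖c‖ * ‖z‖ := by
  have key : ∀ θ : ℝ, ‖Real.cos θ • (c • z).re + Real.sin θ • (c • z).im‖ =
      ‖c‖ * ‖Real.cos (θ - c.arg) • z.re + Real.sin (θ - c.arg) • z.im‖ := by
    intro θ
    have h : Real.cos θ • (c • z).re + Real.sin θ • (c • z).im =
        ‖c‖ • (Real.cos (θ - c.arg) • z.re + Real.sin (θ - c.arg) • z.im) := by
      rw [smul_re, smul_im, Real.cos_sub, Real.sin_sub]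
      nth_rewrite 1 [← Complex.norm_mul_cos_arg c]
      nth_rewrite 1 [← Complex.norm_mul_sin_arg c]
      rw [← Complex.norm_mul_cos_arg c, ← Complex.norm_mul_sin_arg c]
      module
    rw [h, norm_smul, norm_norm]
  rw [norm_def, norm_def]
  simp_rw [key]
  rw [← Real.mul_iSup_of_nonneg (norm_nonneg c)]
  congr 1
  exact (Equiv.subRight c.arg).iSup_congr fun θ => rfl

theorem normedSpaceCore : NormedSpace.Core ℂ (Complexification X) where
  norm_nonneg z := (norm_nonneg _).trans (norm_re_le z)
  norm_smul := norm_smul_eq'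
  norm_triangle z w := by
    refine ciSup_le fun θ => ?_
    have h : Real.cos θ • (z + w).re + Real.sin θ • (z + w).im =
        (Real.cos θ • z.re + Real.sin θ • z.im) + (Real.cos θ • w.re + Real.sin θ • w.im) := by
      rw [add_re, add_im]; module
    rw [h]
    exact (norm_add_le _ _).trans (add_le_add (rotation_le_norm z θ) (rotation_le_norm w θ))
  norm_eq_zero_iff z := by
    constructor
    · intro h
      have h1 := norm_re_le z
      have h2 := norm_im_le z
      rw [h] at h1 h2
      ext
      · exact norm_le_zero_iff.mp h1
      · exact norm_le_zero_iff.mp h2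
    · rintro rfl
      simp [norm_def]

noncomputable instance : NormedAddCommGroup (Complexification X) :=
  NormedAddCommGroup.ofCore normedSpaceCore

noncomputable instance : NormedSpace ℂ (Complexification X) :=
  NormedSpace.ofCore normedSpaceCore

/-- The complexification of a Banach space is a Banach space. -/
instance [CompleteSpace X] : CompleteSpace (Complexification X) := by
  refine Metric.complete_of_cauchySeq_tendsto fun s hs => ?_
  have hre : CauchySeq fun n => (s n).re := by
    rw [Metric.cauchySeq_iff'] at hs ⊢
    intro ε hε
    obtain ⟨N, hN⟩ := hs ε hε
    refine ⟨N, fun n hn => lt_of_le_of_lt ?_ (hN n hn)⟩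
    rw [dist_eq_norm, dist_eq_norm]
    simpa [sub_eq_add_neg] using norm_re_le (s n - s N)
  have him : CauchySeq fun n => (s n).im := by
    rw [Metric.cauchySeq_iff'] at hs ⊢
    intro ε hε
    obtain ⟨N, hN⟩ := hs ε hε
    refine ⟨N, fun n hn => lt_of_le_of_lt ?_ (hN n hn)⟩
    rw [dist_eq_norm, dist_eq_norm]
    simpa [sub_eq_add_neg] using norm_im_le (s n - s N)
  obtain ⟨x, hx⟩ := cauchySeq_tendsto_of_complete hre
  obtain ⟨y, hy⟩ := cauchySeq_tendsto_of_complete him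
  refine ⟨⟨x, y⟩, ?_⟩
  rw [tendsto_iff_norm_sub_tendsto_zero] at hx hy ⊢
  refine squeeze_zero (fun _ => norm_nonneg _) (fun n => ?_) (by simpa using hx.add hy)
  exact (norm_le_add _).trans_eq (by simp [sub_eq_add_neg])

/-- The complexification operator `T_ℂ (x ⊕ iy) = Tx ⊕ iTy`. -/
noncomputable def mapCLM (T : X →L[ℝ] X) : Complexification X →L[ℂ] Complexification X :=
  LinearMap.mkContinuous
    { toFun := fun z => ⟨T z.re, T z.im⟩
      map_add' := fun z w => by ext <;> simp
      map_smul' := fun c z => by ext <;> simp }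
    ‖T‖
    (fun z => by
      refine ciSup_le fun θ => ?_
      have h : Real.cos θ • T z.re + Real.sin θ • T z.im =
          T (Real.cos θ • z.re + Real.sin θ • z.im) := by simp
      refine (congrArg norm h).le.trans ((T.le_opNorm _).trans ?_)
      exact mul_le_mul_of_nonneg_left (rotation_le_norm z θ) (norm_nonneg T))

end Complexification

/-- The full resolvent `ρ_∞(T)` of an operator on a complex space: the unbounded component of the
resolvent set `ρ(T)`, described as the set of those points of `ρ(T)` whose connected component in
`ρ(T)` is unbounded. -/
def fullResolvent {Z : Type u} [NormedAddCommGroup Z] [NormedSpace ℂ Z] (T : Z →L[ℂ] Z) : Set ℂ :=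
  {z ∈ resolventSet ℂ T |
    ¬ Bornology.IsBounded (connectedComponentIn (resolventSet ℂ T) z)}

/-- The full resolvent of an operator on a real space: that of its complexification. -/
def realFullResolvent {X : Type u} [NormedAddCommGroup X] [NormedSpace ℝ X]
    (T : X →L[ℝ] X) : Set ℂ :=
  fullResolvent (Complexification.mapCLM T)

section

variable {𝕜 : Type v} [RCLike 𝕜] {X : Type u} [NormedAddCommGroup X] [NormedSpace 𝕜 X]

variable (𝕜) in
/-- A sequence is a minimal system if it has bounded coordinate functionals. -/
def IsMinimalSystem (x : ℕ → X) : Prop :=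
  ∃ f : ℕ → (X →L[𝕜] 𝕜), ∀ n m : ℕ, f n (x m) = if n = m then 1 else 0

/-- A halfspace: a closed subspace of infinite dimension and infinite codimension. -/
def IsHalfspace (Y : Submodule 𝕜 X) : Prop :=
  IsClosed (Y : Set X) ∧ ¬ FiniteDimensional 𝕜 Y ∧ ¬ FiniteDimensional 𝕜 (X ⧸ Y)

/-- `Y` is almost-invariant under `T` with error subspace `E`: `E` is finite-dimensional and
`TY ⊆ Y + E`. -/
def IsAlmostInvariantWithError (T : X →L[𝕜] X) (Y E : Submodule 𝕜 X) : Prop :=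
  FiniteDimensional 𝕜 E ∧ ∀ y ∈ Y, T y ∈ Y ⊔ E

/-- `T` admits an almost-invariant halfspace some error subspace of which is contained in `W`. -/
def AdmitsAIHSWithErrorIn (T : X →L[𝕜] X) (W : Submodule 𝕜 X) : Prop :=
  ∃ Y : Submodule 𝕜 X, IsHalfspace Y ∧
    ∃ E : Submodule 𝕜 X, E ≤ W ∧ IsAlmostInvariantWithError T Y E

end

/-! For `t` in `(-ε, 0)` the vector `h t = (t - T)⁻¹ e` satisfies `T (h t) = t • h t - e`, so the
closed span `Y` of any family of such vectors has `T Y ⊆ Y + span {e}`. Distinct parameters give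
independent vectors, because minimality rules out polynomial relations along the orbit. The
difficulty is to keep `Y` of infinite codimension. Take an entire function `F(s) = ∑ cₙ sⁿ` with `cₙ
> 0` so small that `gₖ = ∑ₙ cₙ f_{n+k}` converges, where the `f_j` are the coordinate functionals.
Near infinity the Neumann series gives `gₖ((w - T)⁻¹ e) = w^{-k-1} F(1/w)`, and analytic
continuation carries this through the unbounded component. If `F` has infinitely many zeros tending
to `-∞`, their reciprocals accumulate at `0` from the left. Those in `(-ε, 0)` yield vectors `h t`
annihilated by every `gₖ`, and the `gₖ` are independent. -/

open Filter

/-! ### Entire functions with small coefficients and large negative zeros -/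

/-- Power series with positive, arbitrarily rapidly decreasing coefficients can have arbitrarily
large negative zeros. -/
theorem exists_rapidly_decreasing_of_zeros (δ : ℕ → ℝ) (hδ : ∀ n, 0 < δ n) :
    ∃ c : ℕ → ℝ, (∀ n, 0 < c n ∧ c n ≤ δ n) ∧ (∀ r : ℝ, Summable fun n => c n * r ^ n) ∧
      ∀ R : ℝ, ∃ t < -R, ∑' n, c n * t ^ n = 0 := by
  -- The coefficients will satisfy `c n / c (n + 1) = q n`. The factor `S n` makes `q n ≥ δ 0 / δ (n
  -- + 1)`, which forces `c ≤ δ`; as `S` is monotone, the factor `16 ^ n` makes `q` grow by at least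
  -- `16` at each step.
  set S : ℕ → ℝ := fun n => 1 + ∑ i ∈ Finset.range (n + 1), δ 0 / δ (i + 1) with hS
  set q : ℕ → ℝ := fun n => 16 ^ n * S n with hq
  have hS1 : ∀ n, 1 ≤ S n := fun n => le_add_of_nonneg_right
    (Finset.sum_nonneg fun i _ => (div_pos (hδ 0) (hδ _)).le)
  have hSδ : ∀ n, δ 0 / δ (n + 1) ≤ S n := fun n => by
    have := Finset.single_le_sum (f := fun i => δ 0 / δ (i + 1))
      (fun i _ => (div_pos (hδ 0) (hδ _)).le) (Finset.self_mem_range_succ n)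
    simp only [hS]
    linarith
  have hSmono : ∀ n, S n ≤ S (n + 1) := fun n => by
    simp only [hS]
    rw [Finset.sum_range_succ _ (n + 1)]
    have := (div_pos (hδ 0) (hδ (n + 1 + 1))).le
    linarith
  have h16 : ∀ n : ℕ, (1 : ℝ) ≤ 16 ^ n := fun n => one_le_pow₀ (by norm_num)
  have hSq : ∀ n, S n ≤ q n := fun n =>
    le_mul_of_one_le_left (zero_le_one.trans (hS1 n)) (h16 n)
  have hq16 : ∀ n, 16 ^ n ≤ q n := fun n => le_mul_of_one_le_right (by positivity) (hS1 n)
  have hq1 : ∀ n, 1 ≤ q n := fun n => (hS1 n).trans (hSq n)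
  have hq0 : ∀ n, 0 < q n := fun n => one_pos.trans_le (hq1 n)
  have hqs : ∀ n, 16 * q n ≤ q (n + 1) := fun n => by
    simp only [hq, pow_succ]
    have := mul_le_mul_of_nonneg_left (hSmono n) (zero_le_one.trans (h16 n))
    linarith
  have hqmono : Monotone q := monotone_nat_of_le_succ fun n => by linarith [hqs n, hq0 n]
  set c : ℕ → ℝ := fun n => δ 0 / ∏ i ∈ Finset.range n, q i with hc
  have hprod : ∀ n, 1 ≤ ∏ i ∈ Finset.range n, q i := fun n => by
    induction n with
    | zero => simp
    | succ n ih => rw [Finset.prod_range_succ]; exact one_le_mul_of_one_le_of_one_le ih (hq1 n)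
  have hc0 : ∀ n, 0 < c n := fun n => div_pos (hδ 0) (one_pos.trans_le (hprod n))
  have hcs : ∀ n, c (n + 1) * q n = c n := fun n => by
    have h1 := hq0 n
    have h2 := one_pos.trans_le (hprod n)
    simp only [hc]
    rw [Finset.prod_range_succ]
    field_simp
  have hcδ : ∀ n, c n ≤ δ n := by
    rintro (_ | n)
    · simp [hc]
    · simp only [hc]
      rw [div_le_iff₀ (one_pos.trans_le (hprod _)), Finset.prod_range_succ]
      have h1 : δ 0 / δ (n + 1) ≤ (∏ i ∈ Finset.range n, q i) * q n :=
        ((hSδ n).trans (hSq n)).trans (le_mul_of_one_le_left (hq0 n).le (hprod n))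
      rwa [div_le_iff₀ (hδ _), mul_comm] at h1
  have hlarge : ∀ R : ℝ, ∃ n, R < q n := fun R => by
    obtain ⟨n, hn⟩ := pow_unbounded_of_one_lt R (by norm_num : (1 : ℝ) < 16)
    exact ⟨n, hn.trans_le (hq16 n)⟩
  have hsum : ∀ r : ℝ, Summable fun n => c n * r ^ n := fun r => by
    obtain ⟨N, hN⟩ := hlarge (2 * |r|)
    refine summable_of_ratio_norm_eventually_le (r := 1 / 2) (by norm_num) ?_
    filter_upwards [eventually_ge_atTop N] with n hn
    have h1 : |r| ≤ 1 / 2 * q n := by linarith [hqmono hn]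
    rw [norm_mul, norm_mul, norm_pow, norm_pow, Real.norm_eq_abs, Real.norm_eq_abs,
      Real.norm_eq_abs, abs_of_pos (hc0 _), abs_of_pos (hc0 _), ← hcs n, pow_succ]
    have h2 : 0 ≤ c (n + 1) * |r| ^ n := mul_nonneg (hc0 _).le (by positivity)
    nlinarith [mul_le_mul_of_nonneg_left h1 h2]
  have hcont : Continuous fun t : ℝ => ∑' n, c n * t ^ n := by
    rw [continuous_iff_continuousAt]
    intro t
    have : ContinuousOn (fun t : ℝ => ∑' n, c n * t ^ n) (Metric.ball 0 (|t| + 1)) := by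
      refine continuousOn_tsum (fun n => by fun_prop) (hsum (|t| + 1)) fun n x hx => ?_
      rw [mem_ball_zero_iff] at hx
      rw [norm_mul, norm_pow, Real.norm_of_nonneg (hc0 n).le]
      exact mul_le_mul_of_nonneg_left (pow_le_pow_left₀ (norm_nonneg _) hx.le n) (hc0 n).le
    exact this.continuousAt (Metric.isOpen_ball.mem_nhds (by simp))
  -- at `-4 q n` the sum has the sign of its term of index `n + 1`, which dominates the others
  have hsign : ∀ n, 0 < (-1) ^ (n + 1) * ∑' m, c m * (-(4 * q n)) ^ m := fun n => by
    set r := 4 * q n with hr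
    have hr0 : 0 < r := by linarith [hq0 n]
    set a : ℕ → ℝ := fun m => c m * r ^ m with ha
    have ha0 : ∀ m, 0 < a m := fun m => mul_pos (hc0 m) (pow_pos hr0 m)
    have has : ∀ m, a (m + 1) * q m = a m * r := fun m => by
      simp only [ha]; rw [← hcs m]; ring
    -- Consecutive terms have ratio `r / q m` with `r = 4 * q n`: at least `4` for `m ≤ n`, at most
    -- `1 / 4` for `m > n`. Head and tail are thus each at most a third of the peak `a (n + 1)`.
    have hhead : ∀ m ≤ n + 1, 3 * ∑ i ∈ Finset.range m, a i ≤ a m := by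
      intro m
      induction m with
      | zero => intro _; simpa using (ha0 0).le
      | succ m ih =>
        intro hm
        have h1 := ih (by omega)
        have h2 : q m ≤ q n := hqmono (by omega)
        have h3 : 4 * a m ≤ a (m + 1) := by
          have h4 := mul_le_mul_of_nonneg_left h2 (ha0 (m + 1)).le
          have h5 := has m
          rw [hr] at h5
          have h6 : 4 * a m * q n ≤ a (m + 1) * q n := by linarith
          exact le_of_mul_le_mul_right h6 (hq0 n)
        rw [Finset.sum_range_succ]
        linarith
    have htail : ∀ j, a (n + 1 + j) ≤ a (n + 1) * (1 / 4) ^ j := by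
      intro j
      induction j with
      | zero => simp
      | succ j ih =>
        have h1 : 4 * r ≤ q (n + 1 + j) := by
          have := hqmono (show n + 1 ≤ n + 1 + j by omega)
          linarith [hqs n]
        have h2 := mul_le_mul_of_nonneg_left h1 (ha0 (n + 1 + j + 1)).le
        rw [has] at h2
        have h3 : a (n + 1 + j + 1) * 4 ≤ a (n + 1 + j) :=
          le_of_mul_le_mul_right (by linarith) hr0
        rw [pow_succ, ← add_assoc]
        linarith
    have hterm : ∀ m, c m * (-r) ^ m = (-1) ^ m * a m := fun m => by
      rw [neg_pow]; simp only [ha]; ring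
    have hs := hsum (-r)
    simp_rw [hterm] at hs ⊢
    rw [← hs.sum_add_tsum_nat_add (n + 2), Finset.sum_range_succ]
    have h1 : |∑ i ∈ Finset.range (n + 1), (-1) ^ i * a i| ≤ a (n + 1) / 3 := by
      refine (Finset.abs_sum_le_sum_abs _ _).trans ?_
      have h2 := hhead (n + 1) le_rfl
      have h3 : ∀ i, |(-1) ^ i * a i| = a i := fun i => by
        rw [abs_mul, abs_pow, abs_neg, abs_one, one_pow, one_mul, abs_of_pos (ha0 i)]
      simp_rw [h3]
      linarith
    have h2 : |∑' i, (-1) ^ (i + (n + 2)) * a (i + (n + 2))| ≤ a (n + 1) / 3 := by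
      have hg : HasSum (fun i : ℕ => a (n + 1) * (1 / 4) * (1 / 4 : ℝ) ^ i)
          (a (n + 1) * (1 / 4) * (1 - 1 / 4)⁻¹) :=
        (hasSum_geometric_of_lt_one (by norm_num) (by norm_num)).mul_left _
      rw [← Real.norm_eq_abs]
      refine (tsum_of_norm_bounded hg fun i => ?_).trans (le_of_eq (by norm_num; ring))
      rw [norm_mul, norm_pow, norm_neg, norm_one, one_pow, one_mul,
        Real.norm_of_nonneg (ha0 _).le]
      have := htail (i + 1)
      rw [show n + 1 + (i + 1) = i + (n + 2) by omega] at this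
      exact this.trans_eq (by ring)
    rw [abs_le] at h1 h2
    have h3 : ((-1 : ℝ) ^ (n + 1)) * (-1) ^ (n + 1) = 1 := by rw [← mul_pow]; norm_num
    have h4 := ha0 (n + 1)
    rcases neg_one_pow_eq_or ℝ (n + 1) with h | h <;> rw [h] <;> linarith
  refine ⟨c, fun n => ⟨hc0 n, hcδ n⟩, hsum, fun R => ?_⟩
  obtain ⟨n, hn⟩ := hlarge R
  set F : ℝ → ℝ := fun t => ∑' n, c n * t ^ n with hF
  -- The dominant index moves up by one between the two endpoints, so the sign flips.
  have h0 : (0 : ℝ) ∈ Set.uIcc (F (-(4 * q (n + 1)))) (F (-(4 * q n))) := by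
    have h1 : 0 < (-1) ^ (n + 1) * F (-(4 * q n)) := hsign n
    have h2 : 0 < (-1) ^ (n + 1 + 1) * F (-(4 * q (n + 1))) := hsign (n + 1)
    rw [pow_succ] at h2
    rw [Set.mem_uIcc]
    rcases neg_one_pow_eq_or ℝ (n + 1) with h | h <;> rw [h] at h1 h2
    · left; constructor <;> linarith
    · right; constructor <;> linarith
  obtain ⟨t, ht, ht0⟩ := intermediate_value_uIcc hcont.continuousOn h0
  refine ⟨t, ?_, ht0⟩
  rw [Set.uIcc_of_le (by linarith [hqs n, hq0 n])] at ht
  linarith [ht.2, hq0 n]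

/-! ### Neumann series and analytic continuation of the resolvent -/

section Resolvent

variable {Z : Type u} [NormedAddCommGroup Z] [NormedSpace ℂ Z]

theorem differentiable_tsum_mul_pow {c : ℕ → ℂ} (hc : ∀ r : ℝ, Summable fun n => ‖c n‖ * r ^ n) :
    Differentiable ℂ fun w : ℂ => ∑' n, c n * w ^ n := by
  intro w
  have : DifferentiableOn ℂ (fun w : ℂ => ∑' n, c n * w ^ n) (Metric.ball 0 (‖w‖ + 1)) := by
    refine Complex.differentiableOn_tsum_of_summable_norm (hc (‖w‖ + 1)) (fun n => by fun_prop)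
      Metric.isOpen_ball fun n x hx => ?_
    rw [mem_ball_zero_iff] at hx
    rw [norm_mul, norm_pow]
    gcongr
  exact this.differentiableAt (Metric.isOpen_ball.mem_nhds (by simp))

theorem apply_resolvent_of_mem {T : Z →L[ℂ] Z} {z : ℂ} (hz : z ∈ resolventSet ℂ T) (e : Z) :
    T (resolvent T z e) = z • resolvent T z e - e := by
  have h : (algebraMap ℂ (Z →L[ℂ] Z) z - T) * resolvent T z = 1 := Ring.mul_inverse_cancel _ hz
  have h' := congrArg (fun A : Z →L[ℂ] Z => A e) h
  simp only [mul_apply_eq_comp, sub_apply, one_apply_eq_self, Algebra.algebraMap_eq_smul_one,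
    smul_apply] at h'
  exact (sub_eq_iff_eq_add.mp h' ▸ (add_sub_cancel_left _ _).symm)

variable [CompleteSpace Z]

theorem hasSum_apply_resolvent {T : Z →L[ℂ] Z} {z : ℂ} (hz : z ∈ resolventSet ℂ T)
    (hT : ‖T‖ < ‖z‖) (g : Z →L[ℂ] ℂ) (e : Z) :
    HasSum (fun n : ℕ => g ((T ^ n) e) * z⁻¹ ^ (n + 1)) (g (resolvent T z e)) := by
  have hz0 : z ≠ 0 := norm_pos_iff.mp ((norm_nonneg T).trans_lt hT)
  have hlt : ‖z⁻¹ • T‖ < 1 := by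
    rw [norm_smul, norm_inv, inv_mul_lt_iff₀ (norm_pos_iff.mpr hz0), mul_one]
    exact hT
  have hs := summable_geometric_of_norm_lt_one hlt
  have hres : resolvent T z = z⁻¹ • ∑' n : ℕ, (z⁻¹ • T) ^ n := by
    have h1 : (algebraMap ℂ (Z →L[ℂ] Z) z - T) * (z⁻¹ • ∑' n : ℕ, (z⁻¹ • T) ^ n) = 1 := by
      rw [← mul_neg_geom_series _ hlt, mul_smul_comm, ← smul_mul_assoc, smul_sub,
        Algebra.algebraMap_eq_smul_one, smul_smul, inv_mul_cancel₀ hz0, one_smul]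
    have h2 : resolvent T z * (algebraMap ℂ (Z →L[ℂ] Z) z - T) = 1 := Ring.inverse_mul_cancel _ hz
    exact left_inv_eq_right_inv h2 h1
  have h := ((hs.hasSum.const_smul z⁻¹).mapL (ContinuousLinearMap.apply ℂ Z e)).mapL g
  rw [← hres, ContinuousLinearMap.apply_apply] at h
  convert h using 1
  ext n
  simp [smul_pow, pow_succ]
  ring

/-- An analytic function representing `g ((z - T)⁻¹ e)` near infinity represents it on the
unbounded component of the resolvent set. -/
theorem apply_resolvent_eq_of_mem_fullResolvent {T : Z →L[ℂ] Z} {z : ℂ} (hz : z ∈ fullResolvent T)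
    (e : Z) (g : Z →L[ℂ] ℂ) {φ ψ : ℂ → ℂ}
    (hψ : DifferentiableOn ℂ ψ (connectedComponentIn (resolventSet ℂ T) z))
    (hφ : DifferentiableOn ℂ φ (connectedComponentIn (resolventSet ℂ T) z))
    (h : ∀ w ∈ resolventSet ℂ T, ‖T‖ < ‖w‖ → φ w * g (resolvent T w e) = ψ w) :
    φ z * g (resolvent T z e) = ψ z := by
  set C := connectedComponentIn (resolventSet ℂ T) z with hC
  have hopen : IsOpen C := (spectrum.isOpen_resolventSet T).connectedComponentIn
  have hsub : C ⊆ resolventSet ℂ T := connectedComponentIn_subset _ _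
  obtain ⟨w, hwC, hw⟩ : ∃ w ∈ C, ‖T‖ < ‖w‖ := by
    by_contra! hcon
    exact hz.2 (isBounded_iff_forall_norm_le.mpr ⟨‖T‖, hcon⟩)
  have hres : DifferentiableOn ℂ (fun w => g (resolvent T w e)) C := fun w hw =>
    (g.differentiableAt.comp w
      ((spectrum.hasDerivAt_resolvent_const_left (hsub hw)).differentiableAt.clm_apply
        (differentiableAt_const e))).differentiableWithinAt
  refine AnalyticOnNhd.eqOn_of_preconnected_of_eventuallyEq
    (f := fun w => φ w * g (resolvent T w e)) ((hφ.mul hres).analyticOnNhd hopen)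
    (hψ.analyticOnNhd hopen) isPreconnected_connectedComponentIn hwC ?_
    (mem_connectedComponentIn hz.1)
  filter_upwards [hopen.mem_nhds hwC, (isOpen_lt continuous_const continuous_norm).mem_nhds hw]
    with v hv hTv
  exact h v (hsub hv) hTv

/-- Near infinity only the first Neumann term survives, so `w * f ((w - T)⁻¹ e) = 1`. Continued to
`w = 0` this would read `0 = 1`. Excluding `0` is what makes `w⁻¹` analytic on the whole component.
-/
theorem ne_zero_of_mem_fullResolvent {T : Z →L[ℂ] Z} {z : ℂ} (hz : z ∈ fullResolvent T)
    (e : Z) (f : Z →L[ℂ] ℂ) (hf : ∀ m, f ((T ^ m) e) = if m = 0 then 1 else 0) : z ≠ 0 := by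
  rintro rfl
  have := apply_resolvent_eq_of_mem_fullResolvent hz e f (φ := fun w => w) (ψ := fun _ => 1)
    (by fun_prop) (by fun_prop) fun w hw hTw => by
      have hw0 : w ≠ 0 := norm_pos_iff.mp ((norm_nonneg T).trans_lt hTw)
      have h1 := hasSum_apply_resolvent hw hTw f e
      have h2 := hasSum_single (f := fun n : ℕ => f ((T ^ n) e) * w⁻¹ ^ (n + 1)) 0
        fun n hn => by rw [hf, if_neg hn, zero_mul]
      rw [h1.unique h2, hf, if_pos rfl, one_mul, zero_add, pow_one, mul_inv_cancel₀ hw0]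
  simp at this

/-- Near infinity the Neumann series sums to `w⁻¹ ^ (k + 1) * F(w⁻¹)`, with `F` entire; this
persists up to `z`, where `F(z⁻¹) = 0`. -/
theorem apply_resolvent_eq_zero {T : Z →L[ℂ] Z} {z : ℂ} (hz : z ∈ fullResolvent T)
    (e : Z) (f : Z →L[ℂ] ℂ) (hf : ∀ m, f ((T ^ m) e) = if m = 0 then 1 else 0)
    {c : ℕ → ℂ} (hc : ∀ r : ℝ, Summable fun n => ‖c n‖ * r ^ n) (k : ℕ) (g : Z →L[ℂ] ℂ)
    (hg : ∀ m, g ((T ^ m) e) = if k ≤ m then c (m - k) else 0)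
    (h0 : ∑' n, c n * z⁻¹ ^ n = 0) : g (resolvent T z e) = 0 := by
  have hne : ∀ w ∈ connectedComponentIn (resolventSet ℂ T) z, w ≠ 0 := fun w hw =>
    ne_zero_of_mem_fullResolvent ⟨connectedComponentIn_subset _ _ hw, by
      rw [← connectedComponentIn_eq hw]; exact hz.2⟩ e f hf
  have hinv : DifferentiableOn ℂ (fun w : ℂ => w⁻¹)
      (connectedComponentIn (resolventSet ℂ T) z) :=
    fun w hw => (differentiableAt_inv (hne w hw)).differentiableWithinAt
  have := apply_resolvent_eq_of_mem_fullResolvent hz e g (φ := fun _ => 1)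
    (ψ := fun w => w⁻¹ ^ (k + 1) * ∑' n, c n * w⁻¹ ^ n)
    ((hinv.pow (k + 1)).mul ((differentiable_tsum_mul_pow hc).comp_differentiableOn hinv))
    (by fun_prop) fun w hw hTw => by
      have h1 := hasSum_apply_resolvent hw hTw g e
      have h2 : HasSum (fun n : ℕ => c n * w⁻¹ ^ n) (∑' n, c n * w⁻¹ ^ n) := by
        refine (Summable.of_norm ?_).hasSum
        simpa using hc ‖w⁻¹‖
      rw [one_mul]
      refine h1.unique ((hasSum_nat_add_iff' k).mp ?_)
      rw [Finset.sum_eq_zero fun i hi => by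
        rw [hg, if_neg (by simpa using hi), zero_mul], sub_zero]
      have h3 : ∀ n, g ((T ^ (n + k)) e) * w⁻¹ ^ (n + k + 1) = w⁻¹ ^ (k + 1) * (c n * w⁻¹ ^ n) :=
        fun n => by
          rw [hg, if_pos (Nat.le_add_left k n), Nat.add_sub_cancel]
          ring
      simp_rw [h3]
      exact h2.mul_left _
  rw [one_mul] at this
  rw [this, h0, mul_zero]

end Resolvent

/-! ### Construction of the halfspace -/

section Halfspace

variable {𝕜 : Type v} [RCLike 𝕜] {X : Type u} [NormedAddCommGroup X] [NormedSpace 𝕜 X]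

open Polynomial in
/-- Vectors `hᵢ = (μᵢ - T)⁻¹ e` with distinct `μᵢ` are linearly independent if the orbit of `e`
is minimal. -/
theorem linearIndependent_of_isMinimalSystem {T : X →L[𝕜] X} {e : X}
    (hmin : IsMinimalSystem 𝕜 fun n : ℕ => (T ^ n) e) {ι : Type*} {μ : ι → 𝕜}
    (hμ : Function.Injective μ) {h : ι → X} (hh : ∀ i, T (h i) = μ i • h i - e) :
    LinearIndependent 𝕜 h := by
  classical
  obtain ⟨f, hf⟩ := hmin
  have hker : ∀ Q : 𝕜[X], aeval T Q e = 0 → Q = 0 := by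
    intro Q hQ
    ext n
    rw [aeval_eq_sum_range, sum_apply] at hQ
    have h1 := congrArg (f n) hQ
    simp only [map_sum, smul_apply, map_smul, hf, map_zero, smul_eq_mul,
      mul_ite, mul_one, mul_zero, Finset.sum_ite_eq, Finset.mem_range] at h1
    rw [coeff_zero]
    by_cases hn : n < Q.natDegree + 1
    · rwa [if_pos hn] at h1
    · exact coeff_eq_zero_of_natDegree_lt (by omega)
  rw [linearIndependent_iff']
  intro s a ha i hi
  -- Clearing denominators: `∏ (T - μ l)` maps `∑ a j • h j` to `-Q(T) e`. Minimality then forces `Q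
  -- = 0`, and evaluation at `μ i` isolates `a i`, as in Lagrange interpolation.
  set Q : 𝕜[X] := ∑ j ∈ s, C (a j) * ∏ l ∈ s.erase j, (Polynomial.X - C (μ l)) with hQ
  have hfac : ∀ j, aeval T (Polynomial.X - C (μ j)) (h j) = -e := fun j => by
    simp [hh, Algebra.algebraMap_eq_smul_one]
  have hQe : aeval T Q e = 0 := by
    have h1 : aeval T (∏ l ∈ s, (Polynomial.X - C (μ l))) (∑ j ∈ s, a j • h j) = 0 := by rw [ha, map_zero]
    have h2 : aeval T (∏ l ∈ s, (Polynomial.X - C (μ l))) (∑ j ∈ s, a j • h j) = -aeval T Q e := by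
      rw [hQ, map_sum, map_sum, sum_apply, ← Finset.sum_neg_distrib]
      refine Finset.sum_congr rfl fun j hj => ?_
      rw [map_smul, ← Finset.prod_erase_mul _ _ hj, map_mul, map_mul,
        mul_apply_eq_comp, mul_apply_eq_comp, hfac, aeval_C,
        Algebra.algebraMap_eq_smul_one, map_neg, smul_neg]
      simp
    rw [← neg_eq_zero, ← h2, h1]
  have hQi := congrArg (eval (μ i)) (hker Q hQe)
  rw [hQ, eval_finsetSum, Finset.sum_eq_single_of_mem i hi, eval_mul, eval_C, eval_prod,
    eval_zero] at hQi
  · refine (mul_eq_zero.mp hQi).resolve_right (Finset.prod_ne_zero_iff.mpr fun l hl => ?_)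
    rw [eval_sub, eval_X, eval_C, sub_ne_zero]
    exact fun hil => Finset.ne_of_mem_erase hl (hμ hil).symm
  · intro j _ hji
    rw [eval_mul, eval_prod, Finset.prod_eq_zero (Finset.mem_erase.mpr ⟨hji.symm, hi⟩) (by simp),
      mul_zero]

/-- A triangular family of functionals is linearly independent. -/
theorem linearIndependent_of_triangular {g : ℕ → X →L[𝕜] 𝕜} {x : ℕ → X}
    (hlt : ∀ k m, m < k → g k (x m) = 0) (hne : ∀ k, g k (x k) ≠ 0) :
    LinearIndependent 𝕜 g := by
  rw [linearIndependent_iff']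
  intro s a ha i
  induction i using Nat.strong_induction_on with
  | _ i ih =>
    intro hi
    have h1 := congrArg (fun φ : X →L[𝕜] 𝕜 => φ (x i)) ha
    simp only [sum_apply, smul_apply, smul_eq_mul,
      zero_apply] at h1
    rw [Finset.sum_eq_single_of_mem i hi] at h1
    · exact (mul_eq_zero.mp h1).resolve_right (hne i)
    · intro j hj hji
      rcases lt_or_gt_of_ne hji with h | h
      · rw [ih j h hj, zero_mul]
      · rw [hlt j i h, mul_zero]

/-- The functionals descend to the quotient and stay independent there, so its dual is
infinite-dimensional. -/
theorem not_finiteDimensional_quotient_of_linearIndependent {Y : Submodule 𝕜 X}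
    {g : ℕ → X →L[𝕜] 𝕜} (hg : LinearIndependent 𝕜 g) (hY : ∀ k, ∀ y ∈ Y, g k y = 0) :
    ¬ FiniteDimensional 𝕜 (X ⧸ Y) := by
  intro hfin
  let G : ℕ → Module.Dual 𝕜 (X ⧸ Y) := fun k => Y.liftQ (g k : X →ₗ[𝕜] 𝕜) (hY k)
  have hG : LinearIndependent 𝕜 G := by
    rw [linearIndependent_iff'] at hg ⊢
    intro s a ha
    refine hg s a ?_
    ext x
    have h := congrArg (fun φ : Module.Dual 𝕜 (X ⧸ Y) => φ (Y.mkQ x)) ha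
    simp only [LinearMap.sum_apply, LinearMap.smul_apply, LinearMap.zero_apply] at h
    rw [sum_apply, zero_apply]
    exact h
  exact not_finite_iff_infinite.mpr inferInstance hG.finite

/-- The closed span of vectors `hᵢ = (μᵢ - T)⁻¹ e` is almost-invariant with error in `[e]`. -/
theorem admitsAIHSWithErrorIn_of_resolvent_vectors {T : X →L[𝕜] X} {e : X}
    (hmin : IsMinimalSystem 𝕜 fun n : ℕ => (T ^ n) e) {ι : Type*} [Infinite ι] {μ : ι → 𝕜}
    (hμ : Function.Injective μ) {h : ι → X} (hh : ∀ i, T (h i) = μ i • h i - e)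
    {g : ℕ → X →L[𝕜] 𝕜} (hg : LinearIndependent 𝕜 g) (hgh : ∀ k i, g k (h i) = 0) :
    AdmitsAIHSWithErrorIn T (Submodule.span 𝕜 {e}).topologicalClosure := by
  set Y := (Submodule.span 𝕜 (Set.range h)).topologicalClosure with hY
  have hYc : IsClosed (Y : Set X) := Submodule.isClosed_topologicalClosure _
  have hhY : ∀ i, h i ∈ Y := fun i =>
    Submodule.le_topologicalClosure _ (Submodule.subset_span ⟨i, rfl⟩)
  have hle : ∀ W : Submodule 𝕜 X, IsClosed (W : Set X) → (∀ i, h i ∈ W) → Y ≤ W :=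
    fun W hW hi => Submodule.topologicalClosure_minimal _
      (Submodule.span_le.mpr (Set.range_subset_iff.mpr hi)) hW
  refine ⟨Y, ⟨hYc, ?_, ?_⟩, Submodule.span 𝕜 {e}, Submodule.le_topologicalClosure _,
    inferInstance, ?_⟩
  · intro hfin
    have hli := linearIndependent_of_isMinimalSystem hmin hμ hh
    have hliY : LinearIndependent 𝕜 fun i => (⟨h i, hhY i⟩ : Y) :=
      LinearIndependent.of_comp Y.subtype hli
    exact not_finite_iff_infinite.mpr inferInstance hliY.finite
  · refine not_finiteDimensional_quotient_of_linearIndependent hg fun k y hy => ?_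
    have hker := hle (g k).ker (ContinuousLinearMap.isClosed_ker (g k)) (hgh k)
    exact hker hy
  -- Since `Y + span {e}` is closed, so is its preimage under `T`; it suffices to check the
  -- generators `h i`.
  · have hcl := Submodule.isClosed_sup_finiteDimensional Y (Submodule.span 𝕜 {e}) hYc
    intro y hy
    refine hle ((Y ⊔ Submodule.span 𝕜 {e}).comap (T : X →ₗ[𝕜] X)) (hcl.preimage T.continuous)
      (fun i => ?_) hy
    change T (h i) ∈ Y ⊔ Submodule.span 𝕜 {e}
    rw [hh]
    exact Submodule.sub_mem _ (Submodule.mem_sup_left (Y.smul_mem _ (hhY i)))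
      (Submodule.mem_sup_right (Submodule.mem_span_singleton_self e))

/-- If the vectors `h t = (t - T)⁻¹ e` pair with suitable functionals as dictated by the Neumann
series, then `T` has an almost-invariant halfspace. -/
theorem admitsAIHSWithErrorIn_of_pairing {T : X →L[𝕜] X} {e : X}
    (hmin : IsMinimalSystem 𝕜 fun n : ℕ => (T ^ n) e) {ε : ℝ} (hε : 0 < ε) {h : ℝ → X}
    (hh : ∀ t ∈ Set.Ioo (-ε) 0, T (h t) = (t : 𝕜) • h t - e)
    (hpair : ∀ (c : ℕ → ℝ) (k : ℕ) (g : X →L[𝕜] 𝕜), (∀ r : ℝ, Summable fun n => |c n| * r ^ n) →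
      (∀ m, g ((T ^ m) e) = if k ≤ m then (c (m - k) : 𝕜) else 0) →
      ∀ t ∈ Set.Ioo (-ε) 0, ∑' n, c n * t⁻¹ ^ n = 0 → g (h t) = 0) :
    AdmitsAIHSWithErrorIn T (Submodule.span 𝕜 {e}).topologicalClosure := by
  obtain ⟨f, hf⟩ := id hmin
  -- The range up to `2 * n` lets one sequence `c` serve every shift `k`: `n + k ≤ 2 * n` as soon as
  -- `n ≥ k`.
  let M : ℕ → ℝ := fun n => 1 + ∑ j ∈ Finset.range (2 * n + 1), ‖f j‖
  have hM : ∀ n, 0 < M n := fun n => by positivity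
  have hMf : ∀ n j, j ≤ 2 * n → ‖f j‖ ≤ M n := fun n j hj => by
    have := Finset.single_le_sum (f := fun j => ‖f j‖) (fun i _ => norm_nonneg _)
      (Finset.mem_range.mpr (show j < 2 * n + 1 by omega))
    simp only [M]
    linarith
  obtain ⟨c, hc, hcs, hcz⟩ := exists_rapidly_decreasing_of_zeros (fun n => (1 / 2) ^ n / M n)
    fun n => div_pos (by positivity) (hM n)
  have hsum : ∀ k, Summable fun n => (c n : 𝕜) • f (n + k) := fun k => by
    refine Summable.of_norm_bounded_eventually_nat (g := fun n => (1 / 2 : ℝ) ^ n)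
      (summable_geometric_of_lt_one (by norm_num) (by norm_num)) ?_
    filter_upwards [eventually_ge_atTop k] with n hn
    rw [norm_smul, RCLike.norm_ofReal, abs_of_pos (hc n).1]
    calc c n * ‖f (n + k)‖ ≤ (1 / 2) ^ n / M n * M n :=
          mul_le_mul (hc n).2 (hMf n _ (by omega)) (norm_nonneg _)
            (div_pos (by positivity) (hM n)).le
      _ = (1 / 2) ^ n := div_mul_cancel₀ _ (hM n).ne'
  let g : ℕ → X →L[𝕜] 𝕜 := fun k => ∑' n, (c n : 𝕜) • f (n + k)
  have hg : ∀ k m, g k ((T ^ m) e) = if k ≤ m then (c (m - k) : 𝕜) else 0 := fun k m => by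
    have h1 := (hsum k).hasSum.mapL (ContinuousLinearMap.apply 𝕜 𝕜 ((T ^ m) e))
    refine h1.unique ?_
    have h2 : ∀ n, ContinuousLinearMap.apply 𝕜 𝕜 ((T ^ m) e) ((c n : 𝕜) • f (n + k)) =
        if n + k = m then (c n : 𝕜) else 0 := fun n => by
      rw [map_smul, ContinuousLinearMap.apply_apply, hf, smul_eq_mul, mul_ite, mul_one, mul_zero]
    simp_rw [h2]
    by_cases hkm : k ≤ m
    · have h3 := hasSum_single (f := fun n => if n + k = m then (c n : 𝕜) else 0) (m - k)
        fun n hn => if_neg (by omega)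
      rwa [if_pos (Nat.sub_add_cancel hkm), ← if_pos (c := k ≤ m) (t := (c (m - k) : 𝕜)) hkm] at h3
    · rw [if_neg hkm]
      convert hasSum_zero using 1
      ext n
      exact if_neg (by omega)
  have hgli : LinearIndependent 𝕜 g := by
    refine linearIndependent_of_triangular (x := fun m => (T ^ m) e)
      (fun k m hmk => by rw [hg, if_neg (by omega)]) fun k => ?_
    rw [hg, if_pos le_rfl, RCLike.ofReal_ne_zero]
    exact (hc _).1.ne'
  let S : Set ℝ := {s | s < -ε⁻¹ ∧ ∑' n, c n * s ^ n = 0}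
  have hS : S.Infinite := by
    refine Set.infinite_of_not_bddBelow fun ⟨b, hb⟩ => ?_
    obtain ⟨t, ht, ht0⟩ := hcz (max ε⁻¹ (-b))
    have h1 := le_max_left ε⁻¹ (-b)
    have h2 := le_max_right ε⁻¹ (-b)
    have h3 := hb (show t ∈ S from ⟨by linarith, ht0⟩)
    linarith
  have hSI : ∀ s : S, (s : ℝ)⁻¹ ∈ Set.Ioo (-ε) 0 := fun ⟨s, hs, _⟩ => by
    have hε' := inv_pos.mpr hε
    have hs0 : s < 0 := by linarith
    refine ⟨?_, inv_lt_zero.mpr hs0⟩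
    have h1 : ε⁻¹ < -s := by linarith
    have h2 := inv_lt_of_inv_lt₀ hε h1
    rw [inv_neg] at h2
    linarith
  have : Infinite S := hS.to_subtype
  refine admitsAIHSWithErrorIn_of_resolvent_vectors hmin (ι := S)
    (μ := fun s => (((s : ℝ)⁻¹ : ℝ) : 𝕜)) (h := fun s => h (s : ℝ)⁻¹) ?_
    (fun s => hh _ (hSI s)) hgli fun k s => hpair c k (g k) ?_ (hg k) _ (hSI s) ?_
  · intro s t hst
    exact Subtype.ext (inv_injective (RCLike.ofReal_injective hst))
  · intro r
    simpa only [fun n => abs_of_pos (hc n).1] using hcs r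
  · rw [inv_inv]
    exact s.2.2

end Halfspace

/-! ### Transfer between real and complex scalars -/

namespace Complexification

variable {X : Type u} [NormedAddCommGroup X] [NormedSpace ℝ X]

theorem mapCLM_apply (T : X →L[ℝ] X) (z : Complexification X) :
    mapCLM T z = ⟨T z.re, T z.im⟩ := rfl

theorem mapCLM_pow_apply (T : X →L[ℝ] X) (x : X) (n : ℕ) :
    (mapCLM T ^ n) ⟨x, 0⟩ = ⟨(T ^ n) x, 0⟩ := by
  induction n with
  | zero => rfl
  | succ n ih =>
    rw [pow_succ', pow_succ', mul_apply_eq_comp, ih, mapCLM_apply, map_zero,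
      mul_apply_eq_comp]

/-- The complexification `g_ℂ (x ⊕ iy) = g x + i g y` of a real functional. -/
noncomputable def functional (g : X →L[ℝ] ℝ) : Complexification X →L[ℂ] ℂ :=
  LinearMap.mkContinuous
    { toFun := fun z => ⟨g z.re, g z.im⟩
      map_add' := fun z w => by apply Complex.ext <;> simp
      map_smul' := fun c z => by apply Complex.ext <;> simp; ring }
    (‖g‖ + ‖g‖)
    (fun z => by
      refine (Complex.norm_le_abs_re_add_abs_im _).trans ?_
      rw [add_mul]
      exact add_le_add
        ((g.le_opNorm _).trans (mul_le_mul_of_nonneg_left (norm_re_le z) (norm_nonneg g)))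
        ((g.le_opNorm _).trans (mul_le_mul_of_nonneg_left (norm_im_le z) (norm_nonneg g))))

theorem functional_apply (g : X →L[ℝ] ℝ) (z : Complexification X) :
    functional g z = ⟨g z.re, g z.im⟩ := rfl

theorem functional_apply_real (g : X →L[ℝ] ℝ) (x : X) :
    functional g ⟨x, 0⟩ = (g x : ℂ) := by
  rw [functional_apply, map_zero]
  rfl

end Complexification

theorem summable_norm_ofReal {c : ℕ → ℝ} (hc : ∀ r : ℝ, Summable fun n => |c n| * r ^ n) (r : ℝ) :
    Summable fun n => ‖(c n : ℂ)‖ * r ^ n := by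
  simpa using hc r

theorem tsum_ofReal_mul_inv_pow {c : ℕ → ℝ} {t : ℝ} (h : ∑' n, c n * t⁻¹ ^ n = 0) :
    ∑' n, (c n : ℂ) * (t : ℂ)⁻¹ ^ n = 0 := by
  exact_mod_cast congrArg (fun x : ℝ => (x : ℂ)) h


theorem mainTheorem6 :
    (∀ (X : Type u) [NormedAddCommGroup X] [NormedSpace ℝ X] [CompleteSpace X],
      ¬ FiniteDimensional ℝ X →
      ∀ (T : X →L[ℝ] X) (e : X), IsMinimalSystem ℝ (fun n : ℕ => (T ^ n) e) →
      (∃ ε : ℝ, 0 < ε ∧ ∀ t ∈ Set.Ioo (-ε) 0, (t : ℂ) ∈ realFullResolvent T) →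
      AdmitsAIHSWithErrorIn T (Submodule.span ℝ {e}).topologicalClosure) ∧
    (∀ (X : Type v) [NormedAddCommGroup X] [NormedSpace ℂ X] [CompleteSpace X],
      ¬ FiniteDimensional ℂ X →
      ∀ (T : X →L[ℂ] X) (e : X), IsMinimalSystem ℂ (fun n : ℕ => (T ^ n) e) →
      (∃ ε : ℝ, 0 < ε ∧ ∀ t ∈ Set.Ioo (-ε) 0, (t : ℂ) ∈ fullResolvent T) →
      AdmitsAIHSWithErrorIn T (Submodule.span ℂ {e}).topologicalClosure) := by
  constructor
  · intro X _ _ _ _ T e hmin ⟨ε, hε, hres⟩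
    obtain ⟨f, hf⟩ := id hmin
    -- For real `t`, the real part of the complexified resolvent vector satisfies the same equation
    -- over `X`, and complexified functionals act on real parts separately.
    refine admitsAIHSWithErrorIn_of_pairing hmin hε
      (h := fun t => (resolvent (Complexification.mapCLM T) (t : ℂ) ⟨e, 0⟩).re) ?_ ?_
    · intro t ht
      have h := congrArg Complexification.re (apply_resolvent_of_mem (hres t ht).1 ⟨e, 0⟩)
      change T _ = (t : ℂ).re • _ - (t : ℂ).im • _ + -e at h
      rwa [Complex.ofReal_re, Complex.ofReal_im, zero_smul, sub_zero, ← sub_eq_add_neg] at h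
    · intro c k g hc hg t ht h0
      have h := apply_resolvent_eq_zero (hres t ht) ⟨e, 0⟩ (Complexification.functional (f 0))
        (fun m => by
          rw [Complexification.mapCLM_pow_apply, Complexification.functional_apply_real, hf]
          split_ifs <;> simp_all)
        (summable_norm_ofReal hc) k (Complexification.functional g)
        (fun m => by
          rw [Complexification.mapCLM_pow_apply, Complexification.functional_apply_real, hg]
          split_ifs <;> simp)
        (tsum_ofReal_mul_inv_pow h0)
      exact congrArg Complex.re h
  · intro X _ _ _ _ T e hmin ⟨ε, hε, hres⟩
    obtain ⟨f, hf⟩ := id hmin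
    refine admitsAIHSWithErrorIn_of_pairing hmin hε (h := fun t => resolvent T (t : ℂ) e)
      (fun t ht => apply_resolvent_of_mem (hres t ht).1 e) fun c k g hc hg t ht h0 => ?_
    exact apply_resolvent_eq_zero (hres t ht) e (f 0) (fun m => by rw [hf]; simp [eq_comm])
      (summable_norm_ofReal hc) k g hg (tsum_ofReal_mul_inv_pow h0)
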